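/- Let $n>1$ and let $P=P(\rho,S)$ be a smooth function on $\{\rho>0,\ S\in\mathbb R\}$. Consider smooth solutions $(\mathbf u,\rho,S)$ with $\rho>0$, on open regions of space-time $\mathbb R\times\mathbb R^n$, of the compressible Euler equations $$\partial_t\mathbf u+\mathbf u\cdot\nabla\mathbf u+\tfrac1\rho\nabla p=0,\qquad \partial_t\rho+\nabla\cdot(\rho\mathbf u)=0,\qquad \partial_tS+\mathbf u\cdot\nabla S=0,\qquad p=P(\rho,S).$$ Call a smooth function $T(t,\mathbf x,\mathbf u,\rho,S)$ (defined for $\rho>0$) *conserved* if $$\frac{d}{dt}\int_{V(t)}T(t,\mathbf x,\mathbf u,\rho,S)\,d^nx=0$$ for all such solutions and all bounded domains $V(t)$ transported by the flow of $\mathbf u$ (the closure of the initial domain lying in the domain of the flow map). Call it *trivial* if $T$ is identically a spatial divergence $\operatorname{div}\boldsymbol\Theta$ with $\boldsymbol\Theta$ a smooth function of $t,\mathbf x,\mathbf u,\rho,S$ and finitely many $\mathbf x$-derivatives of $\mathbf u,\rho,S$. A *kinematic constant of motion* is given by a $T$ that is conserved and not trivial. Then: 1. For every equation of state $P$, the mass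 $\int_{V(t)}\rho\,d^nx$ and the generalized entropy $\int_{V(t)}\rho f(S)\,d^nx$, for every smooth $f\not\equiv0$, are kinematic constants of motion. 2. There are no others. Suppose that for a dense set of values $S$ there is a $\rho>0$ with $(\partial_\rho P,\partial_SP)(\rho,S)\neq(0,0)$; this holds for instance if $\partial P/\partial S$ vanishes identically on no nonempty open set (as for analytic $P$ with $\partial P/\partial S\not\equiv0$), and for every barotropic $p=P(\rho)$ with $P'\not\equiv0$. Then every conserved $T$ has the form $T=\rho f(S)$ for some smooth $f$. In particular no special equation of state of this kind, and no special dimension, gives further constants of motion. 3. For isentropic flow with constant entropy $S\equiv s_0$, if $\partial_\rho P(\rho,s_0)\neq0$ for some $\rho>0$, then every $T$ that is conserved for all solutions with $S\equiv s_0$ is, at $S=s_0$, a constant multiple of $\rho$. -/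

import Mathlib

open Set MeasureTheory
open scoped ContDiff

noncomputable section

namespace CompressibleFluid

/-- Euclidean space of dimension `n`. -/
abbrev Space (n : ℕ) : Type := EuclideanSpace ℝ (Fin n)

/-- The divergence `∑ᵢ ∂vⁱ/∂xⁱ` of a vector field on Euclidean space. -/
def divergence {n : ℕ} (v : Space n → Space n) (x : Space n) : ℝ :=
  ∑ i, fderiv ℝ v x (EuclideanSpace.single i 1) i

/-- An equation of state `p = P(ρ, S)`, smooth on the physical range `ρ > 0`, `S ∈ ℝ`. -/
def SmoothState (P : ℝ → ℝ → ℝ) : Prop :=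
  ContDiffOn ℝ ∞ (fun z : ℝ × ℝ => P z.1 z.2) {z | 0 < z.1}

/-- The pressure really enters the dynamics: for a dense set of entropy values `s` there is a
density `r > 0` at which the differential of `P` does not vanish. -/
def NondegenerateState (P : ℝ → ℝ → ℝ) : Prop :=
  Dense {s : ℝ | ∃ r : ℝ, 0 < r ∧
    (deriv (fun r' => P r' s) r ≠ 0 ∨ deriv (fun s' => P r s') s ≠ 0)}

/-- `(u, ρ, S)` is a smooth solution with `ρ > 0` of the compressible Euler equations with
equation of state `p = P(ρ, S)` on the open space-time region `Ω`. -/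
structure IsEulerSolution {n : ℕ} (P : ℝ → ℝ → ℝ) (Ω : Set (ℝ × Space n))
    (u : ℝ → Space n → Space n) (ρ S : ℝ → Space n → ℝ) : Prop where
  isOpen : IsOpen Ω
  smooth_velocity : ContDiffOn ℝ ∞ (fun z : ℝ × Space n => u z.1 z.2) Ω
  smooth_density : ContDiffOn ℝ ∞ (fun z : ℝ × Space n => ρ z.1 z.2) Ω
  smooth_entropy : ContDiffOn ℝ ∞ (fun z : ℝ × Space n => S z.1 z.2) Ω
  density_pos : ∀ t x, (t, x) ∈ Ω → 0 < ρ t x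
  /-- `∂ₜu + u·∇u + ρ⁻¹ ∇p = 0` -/
  momentum : ∀ t x, (t, x) ∈ Ω →
    deriv (fun s => u s x) t + fderiv ℝ (fun y => u t y) x (u t x)
      + (ρ t x)⁻¹ • gradient (fun y => P (ρ t y) (S t y)) x = 0
  /-- `∂ₜρ + ∇·(ρu) = 0` -/
  continuity : ∀ t x, (t, x) ∈ Ω →
    deriv (fun s => ρ s x) t + divergence (fun y => ρ t y • u t y) x = 0
  /-- `∂ₜS + u·∇S = 0` -/
  entropy : ∀ t x, (t, x) ∈ Ω →
    deriv (fun s => S s x) t + fderiv ℝ (fun y => S t y) x (u t x) = 0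

/-- `φ` is the (smooth) flow map of the velocity field `u` over the time interval `(a, b)`,
labelling the fluid particles by their position in the open set `W` at time `t₀`. -/
structure IsFlowMap {n : ℕ} (Ω : Set (ℝ × Space n)) (u : ℝ → Space n → Space n)
    (a t₀ b : ℝ) (W : Set (Space n)) (φ : ℝ → Space n → Space n) : Prop where
  time_mem : t₀ ∈ Ioo a b
  isOpen : IsOpen W
  smooth : ContDiffOn ℝ ∞ (fun z : ℝ × Space n => φ z.1 z.2) (Ioo a b ×ˢ W)
  initial : ∀ x ∈ W, φ t₀ x = x
  mem_region : ∀ t ∈ Ioo a b, ∀ x ∈ W, (t, φ t x) ∈ Ω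
  velocity : ∀ t ∈ Ioo a b, ∀ x ∈ W, HasDerivAt (fun s => φ s x) (u t (φ t x)) t

/-- A kinematic density `T(t, x, u, ρ, S)`, smooth on the range `ρ > 0`. -/
def SmoothDensity {n : ℕ} (T : ℝ → Space n → Space n → ℝ → ℝ → ℝ) : Prop :=
  ContDiffOn ℝ ∞ (fun z : ℝ × Space n × Space n × ℝ × ℝ =>
    T z.1 z.2.1 z.2.2.1 z.2.2.2.1 z.2.2.2.2) {z | 0 < z.2.2.2.1}

/-- `d/dt ∫_{V(t)} T(t, x, u, ρ, S) dⁿx = 0` for every solution of the Euler equations whose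
entropy takes values in `A`, and every bounded domain `V(t) = φ t '' V₀` moving with the fluid.
The case `A = univ` is that of general flows, and `A = {s₀}` that of flows in which the entropy
is the constant `s₀`. -/
def IsConserved {n : ℕ} (P : ℝ → ℝ → ℝ) (A : Set ℝ)
    (T : ℝ → Space n → Space n → ℝ → ℝ → ℝ) : Prop :=
  ∀ (Ω : Set (ℝ × Space n)) (u : ℝ → Space n → Space n) (ρ S : ℝ → Space n → ℝ),
    IsEulerSolution P Ω u ρ S → (∀ t x, (t, x) ∈ Ω → S t x ∈ A) →
    ∀ (a t₀ b : ℝ) (W : Set (Space n)) (φ : ℝ → Space n → Space n),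
      IsFlowMap Ω u a t₀ b W φ →
      ∀ V₀ : Set (Space n), IsOpen V₀ → IsConnected V₀ → Bornology.IsBounded V₀ →
        closure V₀ ⊆ W →
        ∀ t ∈ Ioo a b,
          IntegrableOn (fun x => T t x (u t x) (ρ t x) (S t x)) (φ t '' V₀) ∧
          HasDerivAt (fun s => ∫ x in φ s '' V₀, T s x (u s x) (ρ s x) (S s x)) 0 t

/-- The values of the fluid variables `(u, ρ, S)` at a point. -/
abbrev FluidState (n : ℕ) : Type := Space n × ℝ × ℝ

/-- The derivatives of orders `1, …, k` of `(u, ρ, S)` with respect to `x` at a point. -/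
abbrev DerivativeJet (n k : ℕ) : Type :=
  (j : Fin k) → ContinuousMultilinearMap ℝ (fun _ : Fin (j + 1) => Space n) (FluidState n)

/-- The density `T` is locally trivial: it is identically a spatial divergence `div Θ`, where `Θ`
is a smooth function of `t, x, u, ρ, S` and finitely many `x`-derivatives of `u, ρ, S`. -/
def IsTrivialDensity {n : ℕ} (T : ℝ → Space n → Space n → ℝ → ℝ → ℝ) : Prop :=
  ∃ (k : ℕ) (Θ : ℝ × Space n × FluidState n × DerivativeJet n k → Space n),
    ContDiffOn ℝ ∞ Θ {z | 0 < z.2.2.1.2.1} ∧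
    ∀ w : Space n → FluidState n, ContDiff ℝ ∞ w → (∀ x, 0 < (w x).2.1) →
      ∀ t x, T t x (w x).1 (w x).2.1 (w x).2.2 =
        divergence (fun y => Θ (t, y, w y, fun j => iteratedFDeriv ℝ (j + 1) w y)) x

/-- `∫_{V(t)} T dⁿx` is a moving-domain constant of motion: it is conserved on all domains
moving with the fluid, and its density is not locally trivial. -/
def IsConstantOfMotion {n : ℕ} (P : ℝ → ℝ → ℝ)
    (T : ℝ → Space n → Space n → ℝ → ℝ → ℝ) : Prop :=
  IsConserved P univ T ∧ ¬ IsTrivialDensity T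

end CompressibleFluid

end

noncomputable section

namespace CompressibleFluid

/-! Along the flow, entropy is frozen on particles, and density times the Jacobian of the flow map
is frozen too. Pulled back to particle labels, the integral of `ρ f(S)` therefore has an integrand
independent of time (`isConserved_density_mul`). It is not a divergence: two states differing by a
compactly supported density bump would have divergences with equal total integrals, yet the
integrals of `ρ f(S)` differ (`not_isTrivialDensity`).

Conversely, conservation on all small balls of labels makes `T/ρ` constant along every particle path
(`specific_density_along_flow`), so it suffices to test `T` on explicit solutions. There are two
families.

In a homogeneous expansion the pressure is uniform, so this is a solution for every `P`. The central
particle moves freely while its density drops at an arbitrary rate. Comparison with the unexpanded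
motion gives `T` proportional to `ρ` (`density_eq_mul`).

In a drifting vortex the pressure gradient supplies the centripetal force, so a particle of
prescribed position, velocity and state accelerates in a prescribed coordinate direction while its
density and entropy stay fixed. Subtracting the free motion with the same velocity isolates the
acceleration and forces the velocity derivative of `T` to vanish (`fderiv_velocity_eq_zero`). This
needs a second coordinate direction and a direction in state space along which the pressure
increases.

Once `T` ignores velocity, free motion at a suitable speed joins any two events at different times,
so `T` also ignores `t` and `x`. Continuity in `S` extends this from a dense set of entropies to
all. -/

/-! ### Jacobi's formula and exchange of derivatives -/

theorem hasDerivAt_matrix_det {ι : Type*} [Fintype ι] [DecidableEq ι] {M : ℝ → Matrix ι ι ℝ}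
    {B : Matrix ι ι ℝ} {t : ℝ}
    (h : ∀ i j, HasDerivAt (fun s => M s i j) ((B * M t) i j) t) :
    HasDerivAt (fun s => (M s).det) (B.trace * (M t).det) t := by
  -- Row `i` of `B * M t` is a combination of the rows of `M t`; all terms but the `i`-th repeat a
  -- row and drop out of the determinant.
  have key : ∀ i, ((M t).updateRow i ((B * M t) i)).det = B i i * (M t).det := by
    intro i
    have : (B * M t) i = ∑ k, B i k • (M t) k := by
      ext j; simp [Matrix.mul_apply, Finset.sum_apply]
    rw [this, Matrix.det_updateRow_sum, smul_eq_mul]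
  have e : B.trace * (M t).det = ∑ σ : Equiv.Perm ι, (Equiv.Perm.sign σ : ℝ) *
      ∑ i, (∏ j ∈ Finset.univ.erase i, M t j (σ j)) * (B * M t) i (σ i) := by
    rw [Matrix.trace, Finset.sum_mul]
    simp only [Matrix.diag_apply, ← key, Finset.mul_sum]
    rw [Finset.sum_comm]
    refine Finset.sum_congr rfl fun i _ => ?_
    rw [← Matrix.det_transpose, Matrix.det_apply']
    refine Finset.sum_congr rfl fun σ _ => ?_
    rw [← Finset.mul_prod_erase _ _ (Finset.mem_univ i), mul_comm (Matrix.transpose _ _ _)]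
    congr 2
    · refine Finset.prod_congr rfl fun j hj => ?_
      simp [Matrix.updateRow_ne (Finset.ne_of_mem_erase hj)]
    · simp
  rw [e]
  have e2 : (fun s => (M s).det) = fun s => ∑ σ : Equiv.Perm ι, (Equiv.Perm.sign σ : ℝ) *
      ∏ i, M s i (σ i) := by
    funext s
    rw [← Matrix.det_transpose, Matrix.det_apply']
    rfl
  rw [e2]
  refine HasDerivAt.fun_sum fun σ _ => HasDerivAt.const_mul _ ?_
  have := HasDerivAt.fun_finsetProd (u := Finset.univ) (fun i _ => h i (σ i))
  simpa [smul_eq_mul] using this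

theorem hasDerivAt_det {n : ℕ} {A : ℝ → Space n →L[ℝ] Space n} {B : Space n →L[ℝ] Space n} {t : ℝ}
    (h : HasDerivAt A (B ∘L A t) t) :
    HasDerivAt (fun s => (A s).det) ((∑ i, B (EuclideanSpace.single i 1) i) * (A t).det) t := by
  let b := (EuclideanSpace.basisFun (Fin n) ℝ).toBasis
  have e : ∀ C : Space n →L[ℝ] Space n, C.det = (LinearMap.toMatrix b b C.toLinearMap).det :=
    fun C => (LinearMap.det_toMatrix b _).symm
  have hm : ∀ (C : Space n →L[ℝ] Space n) i j,
      LinearMap.toMatrix b b C.toLinearMap i j = C (EuclideanSpace.single j 1) i := by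
    intro C i j
    simp [b, LinearMap.toMatrix_apply]
  simp only [e]
  have htr : (∑ i, B (EuclideanSpace.single i 1) i) = (LinearMap.toMatrix b b B.toLinearMap).trace := by
    simp [Matrix.trace, hm]
  rw [htr]
  apply hasDerivAt_matrix_det
  intro i j
  rw [← LinearMap.toMatrix_comp]
  change HasDerivAt _ (LinearMap.toMatrix b b (B ∘L A t).toLinearMap i j) t
  simp only [hm]
  have h1 := h.clm_apply (hasDerivAt_const t (EuclideanSpace.single j (1:ℝ)))
  have h2 := (EuclideanSpace.proj (𝕜 := ℝ) i : Space n →L[ℝ] ℝ).hasFDerivAt.comp_hasDerivAt t h1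
  simpa [Function.comp_def] using h2

/-- Symmetry of the second derivative. It serves to differentiate the Jacobian matrix of the flow in
time. -/
theorem hasDerivAt_fderiv_comm {E G : Type*} [NormedAddCommGroup E] [NormedSpace ℝ E]
    [NormedAddCommGroup G] [NormedSpace ℝ G] {F : ℝ × E → G} {t : ℝ} {x : E}
    (hF : ContDiffAt ℝ 2 F (t, x)) {V : E → G} {V' : E →L[ℝ] G}
    (hV : ∀ᶠ y in nhds x, HasDerivAt (fun s => F (s, y)) (V y) t) (hV' : HasFDerivAt V V' x) :
    HasDerivAt (fun s => fderiv ℝ (fun y => F (s, y)) x) V' t := by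
  have hd : ∀ᶠ z in nhds (t, x), DifferentiableAt ℝ F z :=
    (hF.eventually (by simp)).mono fun z hz => hz.differentiableAt (by simp)
  have hdt : ∀ᶠ s in nhds t, DifferentiableAt ℝ F (s, x) :=
    (Continuous.prodMk_left x).continuousAt.eventually hd
  have hdx : ∀ᶠ y in nhds x, DifferentiableAt ℝ F (t, y) :=
    (Continuous.prodMk_right t).continuousAt.eventually hd
  have h2 : HasFDerivAt (fderiv ℝ F) (fderiv ℝ (fderiv ℝ F) (t, x)) (t, x) :=
    ((hF.fderiv_right (m := 1) (by norm_num)).differentiableAt (by simp)).hasFDerivAt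
  have hL : ∀ᶠ s in nhds t, fderiv ℝ (fun y => F (s, y)) x =
      (fderiv ℝ F (s, x)).comp (ContinuousLinearMap.inr ℝ ℝ E) := by
    filter_upwards [hdt] with s hs
    exact (hs.hasFDerivAt.comp x (hasFDerivAt_prodMk_right s x)).fderiv
  have hR : ∀ᶠ y in nhds x, fderiv ℝ F (t, y) (1, 0) = V y := by
    filter_upwards [hdx, hV] with y hy hVy
    have h1 : HasDerivAt (fun s : ℝ => (s, y)) ((1 : ℝ), (0 : E)) t :=
      (hasDerivAt_id t).prodMk (hasDerivAt_const t y)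
    exact (hy.hasFDerivAt.comp_hasDerivAt t h1).unique hVy
  have e : V' = (fderiv ℝ (fderiv ℝ F) (t, x) (1, 0)).comp (ContinuousLinearMap.inr ℝ ℝ E) := by
    ext h
    have h3 : HasFDerivAt (fun y => fderiv ℝ F (t, y))
        ((fderiv ℝ (fderiv ℝ F) (t, x)).comp (ContinuousLinearMap.inr ℝ ℝ E)) x :=
      h2.comp x (hasFDerivAt_prodMk_right t x)
    have h4 := h3.clm_apply (hasFDerivAt_const ((1 : ℝ), (0 : E)) x)
    have h5 := (h4.congr_of_eventuallyEq (hR.mono fun y hy => hy.symm)).unique hV'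
    have h6 := (hF.isSymmSndFDerivAt (by simp)) (1, 0) (0, h)
    rw [← h5]
    simp [h6]
  rw [e]
  have h7 : HasDerivAt (fun s => fderiv ℝ F (s, x)) (fderiv ℝ (fderiv ℝ F) (t, x) (1, 0)) t :=
    h2.comp_hasDerivAt t ((hasDerivAt_id t).prodMk (hasDerivAt_const t x))
  have h8 := h7.clm_comp (hasDerivAt_const t (ContinuousLinearMap.inr ℝ ℝ E))
  refine (HasDerivAt.congr_of_eventuallyEq ?_ hL)
  simpa using h8

/-! ### Time slices and the material derivative -/

section Slices

variable {n : ℕ} {G : Type*} [NormedAddCommGroup G] [NormedSpace ℝ G] {Ω : Set (ℝ × Space n)}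
  {ψ : ℝ → Space n → G} {t : ℝ} {x : Space n}

theorem contDiffAt_slice (hΩ : IsOpen Ω)
    (h : ContDiffOn ℝ ∞ (fun z : ℝ × Space n => ψ z.1 z.2) Ω) (hz : (t, x) ∈ Ω) :
    ContDiffAt ℝ ∞ (ψ t) x := by
  have h1 := h.contDiffAt (hΩ.mem_nhds hz)
  exact ContDiffAt.comp (g := fun z : ℝ × Space n => ψ z.1 z.2) (f := fun y => (t, y)) x h1
    (contDiffAt_const.prodMk contDiffAt_id)

theorem differentiableAt_slice (hΩ : IsOpen Ω)
    (h : ContDiffOn ℝ ∞ (fun z : ℝ × Space n => ψ z.1 z.2) Ω) (hz : (t, x) ∈ Ω) :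
    DifferentiableAt ℝ (ψ t) x :=
  (contDiffAt_slice hΩ h hz).differentiableAt (by simp)

theorem hasDerivAt_along_curve (hΩ : IsOpen Ω)
    (h : ContDiffOn ℝ ∞ (fun z : ℝ × Space n => ψ z.1 z.2) Ω) {γ : ℝ → Space n} {v : Space n}
    (hz : (t, γ t) ∈ Ω) (hγ : HasDerivAt γ v t) :
    HasDerivAt (fun s => ψ s (γ s))
      (deriv (fun s => ψ s (γ t)) t + fderiv ℝ (ψ t) (γ t) v) t := by
  obtain ⟨D, hd⟩ : ∃ D, HasFDerivAt (fun z : ℝ × Space n => ψ z.1 z.2) D (t, γ t) :=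
    (h.contDiffAt (hΩ.mem_nhds hz)).differentiableAt (by simp)
  have h1 : HasDerivAt (fun s => ψ s (γ t)) (D (1, 0)) t :=
    HasFDerivAt.comp_hasDerivAt (l := fun z : ℝ × Space n => ψ z.1 z.2)
      (f := fun s => (s, γ t)) t hd ((hasDerivAt_id t).prodMk (hasDerivAt_const t (γ t)))
  have h2 : HasFDerivAt (ψ t) (D ∘L ContinuousLinearMap.inr ℝ ℝ (Space n)) (γ t) :=
    hd.comp (γ t) (hasFDerivAt_prodMk_right t (γ t))
  have h3 : HasDerivAt (fun s => ψ s (γ s)) (D (1, v)) t :=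
    HasFDerivAt.comp_hasDerivAt (l := fun z : ℝ × Space n => ψ z.1 z.2)
      (f := fun s => (s, γ s)) t hd ((hasDerivAt_id t).prodMk hγ)
  rw [h1.deriv, h2.fderiv]
  have e : D (1, 0) + (D ∘L ContinuousLinearMap.inr ℝ ℝ (Space n)) v = D (1, v) := by
    simp [← map_add, Prod.mk_add_mk]
  rwa [e]

end Slices

/-! ### Flow maps: Liouville's formula and injectivity -/

section Flow

variable {n : ℕ} {Ω : Set (ℝ × Space n)} {u : ℝ → Space n → Space n} {a t₀ b : ℝ}
  {W : Set (Space n)} {φ : ℝ → Space n → Space n}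

theorem IsFlowMap.contDiffAt (h : IsFlowMap Ω u a t₀ b W φ) {t : ℝ} (ht : t ∈ Ioo a b)
    {x : Space n} (hx : x ∈ W) :
    ContDiffAt ℝ ∞ (fun z : ℝ × Space n => φ z.1 z.2) (t, x) :=
  h.smooth.contDiffAt ((isOpen_Ioo.prod h.isOpen).mem_nhds ⟨ht, hx⟩)

theorem IsFlowMap.differentiableAt (h : IsFlowMap Ω u a t₀ b W φ) {t : ℝ} (ht : t ∈ Ioo a b)
    {x : Space n} (hx : x ∈ W) : DifferentiableAt ℝ (φ t) x :=
  differentiableAt_slice (isOpen_Ioo.prod h.isOpen) h.smooth ⟨ht, hx⟩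

theorem IsFlowMap.hasDerivAt_fderiv (h : IsFlowMap Ω u a t₀ b W φ) (hΩ : IsOpen Ω)
    (hu : ContDiffOn ℝ ∞ (fun z : ℝ × Space n => u z.1 z.2) Ω) {t : ℝ} (ht : t ∈ Ioo a b)
    {x : Space n} (hx : x ∈ W) :
    HasDerivAt (fun s => fderiv ℝ (φ s) x)
      ((fderiv ℝ (u t) (φ t x)) ∘L (fderiv ℝ (φ t) x)) t := by
  refine hasDerivAt_fderiv_comm (F := fun z : ℝ × Space n => φ z.1 z.2) (V := fun y => u t (φ t y))
    ((h.contDiffAt ht hx).of_le (by norm_cast)) ?_ ?_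
  · filter_upwards [h.isOpen.mem_nhds hx] with y hy using h.velocity t ht y hy
  · exact (differentiableAt_slice hΩ hu (h.mem_region t ht x hx)).hasFDerivAt.comp x
      (h.differentiableAt ht hx).hasFDerivAt

theorem IsFlowMap.hasDerivAt_det (h : IsFlowMap Ω u a t₀ b W φ) (hΩ : IsOpen Ω)
    (hu : ContDiffOn ℝ ∞ (fun z : ℝ × Space n => u z.1 z.2) Ω) {t : ℝ} (ht : t ∈ Ioo a b)
    {x : Space n} (hx : x ∈ W) :
    HasDerivAt (fun s => (fderiv ℝ (φ s) x).det)
      (divergence (u t) (φ t x) * (fderiv ℝ (φ t) x).det) t :=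
  CompressibleFluid.hasDerivAt_det (h.hasDerivAt_fderiv hΩ hu ht hx)

/-- A smooth velocity is Lipschitz near the common point, so ODE uniqueness applies locally. -/
theorem eventuallyEq_of_hasDerivAt {u : ℝ → Space n → Space n} (hΩ : IsOpen Ω)
    (hu : ContDiffOn ℝ ∞ (fun z : ℝ × Space n => u z.1 z.2) Ω) {f g : ℝ → Space n} {t : ℝ}
    (ht : (t, f t) ∈ Ω) (hf : ∀ᶠ s in nhds t, HasDerivAt f (u s (f s)) s)
    (hg : ∀ᶠ s in nhds t, HasDerivAt g (u s (g s)) s) (e : f t = g t) : f =ᶠ[nhds t] g := by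
  obtain ⟨K, N, hN, hK⟩ := ((hu.contDiffAt (hΩ.mem_nhds ht)).of_le
    (n := ∞) (m := 1) (by norm_cast)).exists_lipschitzOnWith
  have hmem : ∀ k : ℝ → Space n, k t = f t → HasDerivAt k (u t (k t)) t →
      ∀ᶠ s in nhds t, (s, k s) ∈ N := by
    intro k hk hd
    have : ContinuousAt (fun s => (s, k s)) t := continuousAt_id.prodMk hd.continuousAt
    exact this.eventually (by simpa [hk] using hN)
  refine ODE_solution_unique_of_eventually (v := u) (s := fun s => {y | (s, y) ∈ N}) (K := K)
    (Filter.Eventually.of_forall fun s => ?_) (hf.and (hmem f rfl hf.self_of_nhds))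
    (hg.and (hmem g e.symm hg.self_of_nhds)) e
  intro y hy y' hy'
  simpa [Prod.edist_eq] using hK hy hy'

theorem IsFlowMap.injOn (h : IsFlowMap Ω u a t₀ b W φ) (hΩ : IsOpen Ω)
    (hu : ContDiffOn ℝ ∞ (fun z : ℝ × Space n => u z.1 z.2) Ω) {t : ℝ} (ht : t ∈ Ioo a b) :
    InjOn (φ t) W := by
  intro x hx y hy hxy
  have hc : ∀ z ∈ W, ContinuousOn (fun s => φ s z) (Ioo a b) := fun z hz s hs =>
    (h.velocity s hs z hz).continuousAt.continuousWithinAt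
  -- The times at which the two paths meet form a set closed in the interval by continuity and open
  -- by local uniqueness. Hence they meet at `t₀`, where the flow is the identity.
  have key : Ioo a b ⊆ {s | φ s x = φ s y} := by
    have hclosed : ∀ s ∈ Ioo a b, s ∈ closure ({s | φ s x = φ s y} ∩ Ioo a b) → φ s x = φ s y := by
      intro s hs hcl
      rw [mem_closure_iff_clusterPt] at hcl
      by_contra hne
      have h1 : ∀ᶠ r in nhds s, φ r x ≠ φ r y :=
        ((h.velocity s hs x hx).continuousAt.prodMk (h.velocity s hs y hy).continuousAt).eventually
          ((isClosed_diagonal.isOpen_compl).mem_nhds (by simpa using hne))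
      rw [clusterPt_principal_iff_frequently] at hcl
      exact (hcl.and_eventually h1).exists.elim fun r hr => hr.2 hr.1.1
    have hopen : ∀ s ∈ Ioo a b, φ s x = φ s y → ∀ᶠ r in nhds s, φ r x = φ r y := by
      intro s hs e
      refine eventuallyEq_of_hasDerivAt hΩ hu (h.mem_region s hs x hx) ?_ ?_ e
      · filter_upwards [isOpen_Ioo.mem_nhds hs] with r hr using h.velocity r hr x hx
      · filter_upwards [isOpen_Ioo.mem_nhds hs] with r hr using h.velocity r hr y hy
    have := isPreconnected_Ioo.subset_of_closure_inter_subset (s := Ioo a b)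
      (u := {s | ∀ᶠ r in nhds s, φ r x = φ r y}) (by
        rw [isOpen_iff_mem_nhds]; intro s hs; exact hs.eventually_nhds)
      ⟨t, ht, hopen t ht hxy⟩ (by
        rintro s ⟨hs, hs'⟩
        refine hopen s hs' (hclosed s hs' ?_)
        rw [mem_closure_iff_nhds] at hs ⊢
        intro U hU
        obtain ⟨r, hr⟩ := hs (U ∩ Ioo a b) (Filter.inter_mem hU (isOpen_Ioo.mem_nhds hs'))
        exact ⟨r, hr.1.1, Filter.Eventually.self_of_nhds hr.2, hr.1.2⟩)
    exact fun s hs => (this hs).self_of_nhds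
  have := key h.time_mem
  simpa [h.initial x hx, h.initial y hy] using this

end Flow

theorem eq_of_hasDerivAt_zero_Ioo {f : ℝ → ℝ} {a b : ℝ} (h : ∀ t ∈ Ioo a b, HasDerivAt f 0 t)
    {s t : ℝ} (hs : s ∈ Ioo a b) (ht : t ∈ Ioo a b) : f s = f t :=
  isOpen_Ioo.is_const_of_deriv_eq_zero isPreconnected_Ioo
    (fun r hr => (h r hr).differentiableAt.differentiableWithinAt) (fun r hr => (h r hr).deriv) hs ht

/-! ### Rules for the divergence -/

section Divergence

variable {n : ℕ} {x : Space n}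

theorem divergence_smul {f : Space n → ℝ} {v : Space n → Space n} (hf : DifferentiableAt ℝ f x)
    (hv : DifferentiableAt ℝ v x) :
    divergence (fun y => f y • v y) x = fderiv ℝ f x (v x) + f x * divergence v x := by
  have e : fderiv ℝ (fun y => f y • v y) x = _ := (hf.hasFDerivAt.smul hv.hasFDerivAt).fderiv
  have hsum : v x = ∑ i, v x i • EuclideanSpace.single i (1 : ℝ) := by
    ext j; simp [Pi.single_apply]
  simp only [divergence, e]
  conv_rhs => rw [hsum]
  simp [Finset.mul_sum, Finset.sum_add_distrib, mul_comm, add_comm]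

theorem divergence_sub {v w : Space n → Space n} (hv : DifferentiableAt ℝ v x)
    (hw : DifferentiableAt ℝ w x) :
    divergence (fun y => v y - w y) x = divergence v x - divergence w x := by
  simp only [divergence, fderiv_fun_sub hv hw]
  simp [Finset.sum_sub_distrib]

end Divergence

/-! ### Lagrangian form of the conservation law -/

section Transport

variable {n : ℕ} {P : ℝ → ℝ → ℝ} {Ω : Set (ℝ × Space n)} {u : ℝ → Space n → Space n}
  {ρ S : ℝ → Space n → ℝ} {a t₀ b : ℝ} {W : Set (Space n)} {φ : ℝ → Space n → Space n}

theorem entropy_along_flow (hE : IsEulerSolution P Ω u ρ S) (hF : IsFlowMap Ω u a t₀ b W φ)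
    {t : ℝ} (ht : t ∈ Ioo a b) {x : Space n} (hx : x ∈ W) : S t (φ t x) = S t₀ x := by
  have := eq_of_hasDerivAt_zero_Ioo (f := fun s => S s (φ s x)) (fun s hs => by
    have h := hasDerivAt_along_curve hE.isOpen hE.smooth_entropy (hF.mem_region s hs x hx)
      (hF.velocity s hs x hx)
    rwa [hE.entropy s _ (hF.mem_region s hs x hx)] at h) ht hF.time_mem
  simpa [hF.initial x hx] using this

theorem density_mul_det (hE : IsEulerSolution P Ω u ρ S) (hF : IsFlowMap Ω u a t₀ b W φ)
    {t : ℝ} (ht : t ∈ Ioo a b) {x : Space n} (hx : x ∈ W) :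
    ρ t (φ t x) * (fderiv ℝ (φ t) x).det = ρ t₀ x := by
  have := eq_of_hasDerivAt_zero_Ioo (f := fun s => ρ s (φ s x) * (fderiv ℝ (φ s) x).det)
    (fun s hs => by
      have hm := hF.mem_region s hs x hx
      have h := (hasDerivAt_along_curve hE.isOpen hE.smooth_density hm
        (hF.velocity s hs x hx)).mul (hF.hasDerivAt_det hE.isOpen hE.smooth_velocity hs hx)
      have hc := hE.continuity s _ hm
      rw [divergence_smul (differentiableAt_slice hE.isOpen hE.smooth_density hm)
        (differentiableAt_slice hE.isOpen hE.smooth_velocity hm)] at hc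
      refine h.congr_deriv ?_
      -- The continuity equation cancels the rate `div u` from Liouville's formula.
      linear_combination (fderiv ℝ (φ s) x).det * hc) ht hF.time_mem
  have h1 : fderiv ℝ (φ t₀) x = ContinuousLinearMap.id ℝ (Space n) := by
    have : φ t₀ =ᶠ[nhds x] id := by
      filter_upwards [hF.isOpen.mem_nhds hx] with y hy using hF.initial y hy
    rw [this.fderiv_eq, fderiv_id]
  have h2 : (ContinuousLinearMap.id ℝ (Space n)).det = 1 := LinearMap.det_id
  simpa [hF.initial x hx, h1, h2] using this

theorem initial_mem_region (hF : IsFlowMap Ω u a t₀ b W φ) {x : Space n} (hx : x ∈ W) :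
    (t₀, x) ∈ Ω := by
  simpa [hF.initial x hx] using hF.mem_region t₀ hF.time_mem x hx

theorem abs_det_flow (hE : IsEulerSolution P Ω u ρ S) (hF : IsFlowMap Ω u a t₀ b W φ)
    {t : ℝ} (ht : t ∈ Ioo a b) {x : Space n} (hx : x ∈ W) :
    |(fderiv ℝ (φ t) x).det| = ρ t₀ x / ρ t (φ t x) := by
  have h1 := hE.density_pos _ _ (hF.mem_region t ht x hx)
  have h2 := hE.density_pos _ _ (initial_mem_region hF hx)
  have h3 : (fderiv ℝ (φ t) x).det = ρ t₀ x / ρ t (φ t x) := by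
    rw [← density_mul_det hE hF ht hx]; field_simp
  rw [h3, abs_of_pos (div_pos h2 h1)]

/-- Mass conservation turns the Jacobian into a ratio of densities, so the domain of integration no
longer moves. -/
theorem setIntegral_flow (hE : IsEulerSolution P Ω u ρ S) (hF : IsFlowMap Ω u a t₀ b W φ)
    {V : Set (Space n)} (hV : IsOpen V) (hVW : V ⊆ W) {t : ℝ} (ht : t ∈ Ioo a b)
    (g : Space n → ℝ) :
    ∫ x in φ t '' V, g x = ∫ x in V, ρ t₀ x * (g (φ t x) / ρ t (φ t x)) := by
  rw [integral_image_eq_integral_abs_det_fderiv_smul volume hV.measurableSet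
    (fun x hx => (hF.differentiableAt ht (hVW hx)).hasFDerivAt.hasFDerivWithinAt)
    ((hF.injOn hE.isOpen hE.smooth_velocity ht).mono hVW)]
  refine setIntegral_congr_fun hV.measurableSet fun x hx => ?_
  simp only [abs_det_flow hE hF ht (hVW hx), smul_eq_mul]
  ring

theorem integrableOn_flow_iff (hE : IsEulerSolution P Ω u ρ S) (hF : IsFlowMap Ω u a t₀ b W φ)
    {V : Set (Space n)} (hV : IsOpen V) (hVW : V ⊆ W) {t : ℝ} (ht : t ∈ Ioo a b)
    (g : Space n → ℝ) :
    IntegrableOn g (φ t '' V) ↔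
      IntegrableOn (fun x => ρ t₀ x * (g (φ t x) / ρ t (φ t x))) V := by
  rw [integrableOn_image_iff_integrableOn_abs_det_fderiv_smul volume hV.measurableSet
    (fun x hx => (hF.differentiableAt ht (hVW hx)).hasFDerivAt.hasFDerivWithinAt)
    ((hF.injOn hE.isOpen hE.smooth_velocity ht).mono hVW)]
  refine integrableOn_congr_fun (fun x hx => ?_) hV.measurableSet
  simp only [abs_det_flow hE hF ht (hVW hx), smul_eq_mul]
  ring

/-- The mass-weighted integral of any smooth function of the entropy moves with the flow. -/
theorem isConserved_density_mul {f : ℝ → ℝ} (hf : Continuous f) (A : Set ℝ) :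
    IsConserved (n := n) P A (fun _ _ _ ρ S => ρ * f S) := by
  intro Ω u ρ S hE _ a t₀ b W φ hF V hV _ hVb hVW
  have hVW' : V ⊆ W := subset_closure.trans hVW
  have key : ∀ t ∈ Ioo a b, ∀ x ∈ V,
      ρ t₀ x * (ρ t (φ t x) * f (S t (φ t x)) / ρ t (φ t x)) = ρ t₀ x * f (S t₀ x) := by
    intro t ht x hx
    have h1 := (hE.density_pos _ _ (hF.mem_region t ht x (hVW' hx))).ne'
    rw [entropy_along_flow hE hF ht (hVW' hx)]
    field_simp
  intro t ht
  constructor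
  · rw [integrableOn_flow_iff hE hF hV hVW' ht,
      integrableOn_congr_fun (fun x hx => key t ht x hx) hV.measurableSet]
    refine (ContinuousOn.integrableOn_compact (K := closure V) hVb.isCompact_closure ?_).mono_set
      subset_closure
    intro x hx
    have hm := initial_mem_region hF (hVW hx)
    exact (((differentiableAt_slice hE.isOpen hE.smooth_density hm).continuousAt).mul
      (hf.continuousAt.comp
      (differentiableAt_slice hE.isOpen hE.smooth_entropy hm).continuousAt)).continuousWithinAt
  · refine (hasDerivAt_const t (∫ x in V, ρ t₀ x * f (S t₀ x))).congr_of_eventuallyEq ?_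
    filter_upwards [isOpen_Ioo.mem_nhds ht] with s hs
    rw [setIntegral_flow hE hF hV hVW' hs]
    exact setIntegral_congr_fun hV.measurableSet fun x hx => key s hs x hx

/-- A strict inequality at the centre would persist on a small ball and separate the integrals. -/
theorem eq_of_setIntegral_ball_eq {f g : Space n → ℝ} {x : Space n} (hW : W ∈ nhds x)
    (hf : ContinuousOn f W) (hg : ContinuousOn g W)
    (h : ∀ r > 0, Metric.closedBall x r ⊆ W →
      ∫ y in Metric.ball x r, f y = ∫ y in Metric.ball x r, g y) : f x = g x := by
  wlog hlt : f x < g x generalizing f g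
  · rcases lt_trichotomy (f x) (g x) with h1 | h1 | h1
    · exact absurd h1 hlt
    · exact h1
    · exact (this hg hf (fun r hr hr' => (h r hr hr').symm) h1).symm
  exfalso
  have hev : ∀ᶠ y in nhds x, f y < g y :=
    (hf.continuousAt hW).eventually_lt (hg.continuousAt hW) hlt
  obtain ⟨r, hr, hrs⟩ := Metric.nhds_basis_closedBall.mem_iff.1 (Filter.inter_mem hW hev)
  have hrW : Metric.closedBall x r ⊆ W := fun y hy => (hrs hy).1
  have hi : ∀ k : Space n → ℝ, ContinuousOn k W → IntegrableOn k (Metric.ball x r) := fun k hk =>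
    ((hk.mono hrW).integrableOn_compact (isCompact_closedBall x r)).mono_set
      Metric.ball_subset_closedBall
  have hpos : 0 < ∫ y in Metric.ball x r, (g y - f y) := by
    rw [setIntegral_pos_iff_support_of_nonneg_ae]
    · refine lt_of_lt_of_le (Metric.measure_ball_pos volume x hr) (measure_mono fun y hy => ?_)
      exact ⟨(sub_pos.2 (hrs (Metric.ball_subset_closedBall hy)).2).ne', hy⟩
    · refine (ae_restrict_iff' Metric.isOpen_ball.measurableSet).2 (Filter.Eventually.of_forall
        fun y hy => (sub_pos.2 (hrs (Metric.ball_subset_closedBall hy)).2).le)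
    · exact (hi g hg).sub (hi f hf)
  rw [integral_sub (hi g hg) (hi f hf), h r hr hrW, sub_self] at hpos
  exact lt_irrefl _ hpos

/-- A conserved density per unit mass is constant along particle paths. -/
theorem specific_density_along_flow {T : ℝ → Space n → Space n → ℝ → ℝ → ℝ} {A : Set ℝ}
    (hT : SmoothDensity T) (hC : IsConserved P A T) (hE : IsEulerSolution P Ω u ρ S)
    (hA : ∀ t x, (t, x) ∈ Ω → S t x ∈ A) (hF : IsFlowMap Ω u a t₀ b W φ)
    {t : ℝ} (ht : t ∈ Ioo a b) {x : Space n} (hx : x ∈ W) :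
    T t (φ t x) (u t (φ t x)) (ρ t (φ t x)) (S t (φ t x)) / ρ t (φ t x) =
      T t₀ x (u t₀ x) (ρ t₀ x) (S t₀ x) / ρ t₀ x := by
  have hcont : ∀ s ∈ Ioo a b, ContinuousOn (fun y => ρ t₀ y *
      (T s (φ s y) (u s (φ s y)) (ρ s (φ s y)) (S s (φ s y)) / ρ s (φ s y))) W := by
    intro s hs y hy
    have hm := hF.mem_region s hs y hy
    have hφ := (hF.differentiableAt hs hy).continuousAt
    have h0 := (differentiableAt_slice hE.isOpen hE.smooth_density
      (initial_mem_region hF hy)).continuousAt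
    have hu := ContinuousAt.comp (f := φ s)
      (differentiableAt_slice hE.isOpen hE.smooth_velocity hm).continuousAt hφ
    have hρ := ContinuousAt.comp (f := φ s)
      (differentiableAt_slice hE.isOpen hE.smooth_density hm).continuousAt hφ
    have hS := ContinuousAt.comp (f := φ s)
      (differentiableAt_slice hE.isOpen hE.smooth_entropy hm).continuousAt hφ
    have hp := hE.density_pos _ _ hm
    have hopen : IsOpen {z : ℝ × Space n × Space n × ℝ × ℝ | 0 < z.2.2.2.1} :=
      isOpen_lt (by fun_prop) (by fun_prop)
    have hTc : ContinuousAt (fun z : ℝ × Space n × Space n × ℝ × ℝ =>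
        T z.1 z.2.1 z.2.2.1 z.2.2.2.1 z.2.2.2.2)
        (s, φ s y, u s (φ s y), ρ s (φ s y), S s (φ s y)) :=
      hT.continuousOn.continuousAt (hopen.mem_nhds hp)
    have h2 := ContinuousAt.comp (f := fun y => (s, φ s y, u s (φ s y), ρ s (φ s y), S s (φ s y)))
      hTc (continuousAt_const.prodMk (hφ.prodMk (hu.prodMk (hρ.prodMk hS))))
    exact (h0.mul (h2.div₀ hρ hp.ne')).continuousWithinAt
  have h := eq_of_setIntegral_ball_eq (hF.isOpen.mem_nhds hx) (hcont t ht) (hcont t₀ hF.time_mem)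
    (fun r hr hrW => by
      have hVW := Metric.ball_subset_closedBall.trans hrW
      have hc := hC Ω u ρ S hE hA a t₀ b W φ hF (Metric.ball x r) Metric.isOpen_ball
        (Metric.isConnected_ball hr) Metric.isBounded_ball
        ((Metric.closure_ball_subset_closedBall).trans hrW)
      have h1 := eq_of_hasDerivAt_zero_Ioo (fun s hs => (hc s hs).2) ht hF.time_mem
      rwa [setIntegral_flow hE hF Metric.isOpen_ball hVW ht,
        setIntegral_flow hE hF Metric.isOpen_ball hVW hF.time_mem] at h1)
  have hp := hE.density_pos _ _ (initial_mem_region hF hx)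
  simpa [hF.initial x hx, hp.ne'] using h

end Transport

/-! ### Nontriviality of the densities -/

/-- Integration by parts of each component against the constant `1`. -/
theorem integral_divergence_eq_zero {n : ℕ} {v : Space n → Space n} (hv : ContDiff ℝ 1 v)
    (hc : HasCompactSupport v) : ∫ x, divergence v x = 0 := by
  have hv' : ∀ i x, fderiv ℝ v x (EuclideanSpace.single i 1) i =
      fderiv ℝ (fun y => v y i) x (EuclideanSpace.single i 1) := by
    intro i x
    have := ((EuclideanSpace.proj (𝕜 := ℝ) i : Space n →L[ℝ] ℝ).hasFDerivAt.comp x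
      (hv.differentiable (by simp) x).hasFDerivAt).fderiv
    have e : fderiv ℝ (fun y => v y i) x =
      (EuclideanSpace.proj (𝕜 := ℝ) i : Space n →L[ℝ] ℝ).comp (fderiv ℝ v x) := this
    rw [e]; rfl
  have hvi : ∀ i, ContDiff ℝ 1 (fun y => v y i) := fun i =>
    (EuclideanSpace.proj (𝕜 := ℝ) i : Space n →L[ℝ] ℝ).contDiff.comp hv
  have hci : ∀ i, HasCompactSupport (fun y => v y i) := fun i =>
    hc.comp_left (g := fun z : Space n => z i) rfl
  have hint : ∀ i, Integrable
      (fun x => fderiv ℝ (fun y => v y i) x (EuclideanSpace.single i 1)) := fun i =>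
    ((((hvi i).continuous_fderiv (by simp)).clm_apply continuous_const)).integrable_of_hasCompactSupport
      ((hci i).fderiv_apply (𝕜 := ℝ) _)
  simp only [divergence, hv']
  rw [integral_finsetSum _ fun i _ => hint i]
  refine Finset.sum_eq_zero fun i _ => ?_
  have := integral_mul_fderiv_eq_neg_fderiv_mul_of_integrable (μ := (volume : Measure (Space n)))
    (f := fun _ => (1 : ℝ)) (g := fun y => v y i) (v := EuclideanSpace.single i 1)
    (by simp) (by simpa using hint i)
    (by simpa using (hvi i).continuous.integrable_of_hasCompactSupport (hci i))
    (fun x _ => differentiableAt_const _) (fun x _ => (hvi i).differentiable (by simp) x)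
  simpa using this

theorem not_isTrivialDensity {n : ℕ} {f : ℝ → ℝ} (hf : f ≠ 0) :
    ¬ IsTrivialDensity (n := n) (fun _ _ _ ρ S => ρ * f S) := by
  rintro ⟨k, Θ, hΘ, h⟩
  obtain ⟨s, hs⟩ := Function.ne_iff.1 hf
  let β : ContDiffBump (0 : Space n) := default
  have hβ : ContDiff ℝ ∞ (β : Space n → ℝ) := β.contDiff
  let J : (Space n → FluidState n) → Space n → ℝ × Space n × FluidState n × DerivativeJet n k :=
    fun w y => (0, y, w y, fun j => iteratedFDeriv ℝ (j + 1) w y)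
  have hJ : ∀ w : Space n → FluidState n, ContDiff ℝ ∞ w → (∀ x, 0 < (w x).2.1) →
      ContDiff ℝ ∞ (fun y => Θ (J w y)) := by
    intro w hw hp
    have hj : ContDiff ℝ ∞ (J w) := by
      refine contDiff_const.prodMk (contDiff_id.prodMk (hw.prodMk (contDiff_pi.2 fun j => ?_)))
      exact hw.iteratedFDeriv_right (by norm_cast)
    exact hΘ.comp_contDiff hj hp
  let w₁ : Space n → FluidState n := fun _ => (0, 1, s)
  let w₂ : Space n → FluidState n := fun x => (0, 1 + β x, s)
  have hw₁ : ContDiff ℝ ∞ w₁ := contDiff_const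
  have hw₂ : ContDiff ℝ ∞ w₂ := contDiff_const.prodMk ((contDiff_const.add hβ).prodMk contDiff_const)
  have hp₁ : ∀ x, 0 < (w₁ x).2.1 := fun x => one_pos
  have hp₂ : ∀ x, 0 < (w₂ x).2.1 := fun x => add_pos_of_pos_of_nonneg one_pos β.nonneg
  have hd₁ := hJ w₁ hw₁ hp₁
  have hd₂ := hJ w₂ hw₂ hp₂
  -- Off the support of the bump the two states agree near the point, hence so do their jets and the
  -- values of `Θ`.
  have hsupp : HasCompactSupport (fun y => Θ (J w₂ y) - Θ (J w₁ y)) := by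
    refine HasCompactSupport.intro β.hasCompactSupport fun x hx => ?_
    have he : w₂ =ᶠ[nhds x] w₁ := by
      filter_upwards [notMem_tsupport_iff_eventuallyEq.1 hx] with y hy
      simp only [w₁, w₂, hy, Pi.zero_apply, add_zero]
    have : J w₂ x = J w₁ x := by
      simp only [J, he.self_of_nhds]
      congr 3
      funext j
      exact (he.iteratedFDeriv ℝ _).self_of_nhds
    rw [this, sub_self]
  have h0 := integral_divergence_eq_zero ((hd₂.sub hd₁).of_le (by norm_cast)) hsupp
  have hval : ∀ x, divergence (fun y => Θ (J w₂ y) - Θ (J w₁ y)) x = β x * f s := by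
    intro x
    rw [divergence_sub (hd₂.differentiable (by simp) x) (hd₁.differentiable (by simp) x),
      ← h w₁ hw₁ hp₁ 0 x, ← h w₂ hw₂ hp₂ 0 x]
    simp only [w₁, w₂]
    ring
  simp only [hval, integral_mul_const] at h0
  exact (mul_ne_zero β.integral_pos.ne' hs) h0

/-! ### Homogeneous expansions -/

section Expansion

variable {n : ℕ}

/-- Velocity of a gas expanding homogeneously about a freely moving centre. -/
def expansionVelocity (l t₀ : ℝ) (x₀ u₀ : Space n) (t : ℝ) (x : Space n) : Space n :=
  u₀ + (l / (1 + l * (t - t₀))) • (x - x₀ - (t - t₀) • u₀)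

theorem divergence_const_add_smul (c : ℝ) (u₀ y : Space n) {x : Space n} :
    divergence (fun z => u₀ + c • (z - y)) x = n * c := by
  have h : HasFDerivAt (fun z => u₀ + c • (z - y)) (c • ContinuousLinearMap.id ℝ (Space n)) x :=
    (((hasFDerivAt_id x).sub_const y).const_smul c).const_add u₀
  simp [divergence, h.fderiv]

/-- Every particle keeps a constant velocity and the pressure is uniform in space, so the equation
of state plays no role. -/
theorem isEulerSolution_expansion (P : ℝ → ℝ → ℝ) (l t₀ : ℝ) (x₀ u₀ : Space n) {r : ℝ}
    (hr : 0 < r) (s : ℝ) :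
    IsEulerSolution P {z : ℝ × Space n | 0 < 1 + l * (z.1 - t₀)} (expansionVelocity l t₀ x₀ u₀)
      (fun t _ => r / (1 + l * (t - t₀)) ^ n) (fun _ _ => s) where
  isOpen := isOpen_lt (by fun_prop) (by fun_prop)
  smooth_velocity := by
    have h1 : ContDiffOn ℝ ∞ (fun z : ℝ × Space n => l / (1 + l * (z.1 - t₀)))
        {z : ℝ × Space n | 0 < 1 + l * (z.1 - t₀)} :=
      ContDiffOn.div (by fun_prop) (by fun_prop) (fun z hz => ne_of_gt hz)
    exact contDiffOn_const.add (h1.smul (by fun_prop))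
  smooth_density :=
    ContDiffOn.div (by fun_prop) (by fun_prop) (fun z hz => (pow_pos hz n).ne')
  smooth_entropy := contDiffOn_const
  density_pos t x h := div_pos hr (pow_pos h n)
  momentum t x h := by
    have hk : 1 + l * (t - t₀) ≠ 0 := ne_of_gt h
    have hκ : HasDerivAt (fun t => 1 + l * (t - t₀)) l t := by
      simpa using (((hasDerivAt_id t).sub_const t₀).const_mul l).const_add 1
    have hd : HasDerivAt (fun t' => expansionVelocity l t₀ x₀ u₀ t' x) _ t :=
      (((hasDerivAt_const t l).div hκ hk).smul
        ((((hasDerivAt_id t).sub_const t₀).smul_const u₀).const_sub (x - x₀))).const_add u₀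
    have hx : HasFDerivAt (fun y => expansionVelocity l t₀ x₀ u₀ t y)
        ((l / (1 + l * (t - t₀))) • ContinuousLinearMap.id ℝ (Space n)) x :=
      ((((hasFDerivAt_id x).sub_const x₀).sub_const ((t - t₀) • u₀)).const_smul
        (l / (1 + l * (t - t₀)))).const_add u₀
    have hg : gradient (fun _ : Space n => P (r / (1 + l * (t - t₀)) ^ n) s) x = 0 := by
      simp [gradient]
    rw [hg, hd.deriv, hx.fderiv]
    simp only [expansionVelocity]
    ext i
    simp
    field_simp
    ring
  continuity t x h := by
    have hk : 1 + l * (t - t₀) ≠ 0 := ne_of_gt h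
    have hκ : HasDerivAt (fun t => 1 + l * (t - t₀)) l t := by
      simpa using (((hasDerivAt_id t).sub_const t₀).const_mul l).const_add 1
    have hd : HasDerivAt (fun t' => r / (1 + l * (t' - t₀)) ^ n) _ t :=
      (hasDerivAt_const t r).div (hκ.pow n) (pow_ne_zero n hk)
    have hu : expansionVelocity l t₀ x₀ u₀ t =
        fun z => u₀ + (l / (1 + l * (t - t₀))) • (z - (x₀ + (t - t₀) • u₀)) := by
      funext z; simp [expansionVelocity, sub_sub]
    rw [hd.deriv, divergence_smul (differentiableAt_const _) (by rw [hu]; fun_prop), hu,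
      divergence_const_add_smul]
    rcases n with _ | n
    · simp
    · simp [pow_succ]
      field_simp
      ring
  entropy t x h := by simp

theorem isFlowMap_expansion {l : ℝ} (hl : 0 ≤ l) (t₀ : ℝ) (x₀ u₀ : Space n) {b : ℝ} (hb : t₀ < b) :
    IsFlowMap {z : ℝ × Space n | 0 < 1 + l * (z.1 - t₀)} (expansionVelocity l t₀ x₀ u₀)
      (t₀ - 1 / (1 + l)) t₀ b univ (fun t x => x + (t - t₀) • (u₀ + l • (x - x₀))) := by
  have hpos : ∀ t ∈ Ioo (t₀ - 1 / (1 + l)) b, 0 < 1 + l * (t - t₀) := by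
    intro t ht
    have h1 : 0 < 1 + l := by linarith
    have h2 : -(1 / (1 + l)) ≤ t - t₀ := by linarith [ht.1]
    have h3 : l * (-(1 / (1 + l))) ≤ l * (t - t₀) := mul_le_mul_of_nonneg_left h2 hl
    -- The initial time `t₀ - 1 / (1 + l)` keeps the scale factor positive, and remains meaningful
    -- when `l = 0`.
    have h4 : 1 + l * (-(1 / (1 + l))) = 1 / (1 + l) := by field_simp; ring
    have h5 : 0 < 1 / (1 + l) := by positivity
    linarith
  refine ⟨⟨by have : 0 < 1 / (1 + l) := by positivity
              linarith, hb⟩, isOpen_univ, ?_, by simp, fun t ht x _ => hpos t ht, ?_⟩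
  · apply ContDiff.contDiffOn; fun_prop
  · intro t ht x _
    have hk := (hpos t ht).ne'
    have hd : HasDerivAt (fun t => x + (t - t₀) • (u₀ + l • (x - x₀))) _ t :=
      (((hasDerivAt_id t).sub_const t₀).smul_const (u₀ + l • (x - x₀))).const_add x
    refine hd.congr_deriv ?_
    ext i
    simp [expansionVelocity]
    field_simp
    ring

/-- Invariance of a conserved density per unit mass under expansion along free motion. -/
theorem specific_density_expansion {P : ℝ → ℝ → ℝ} {T : ℝ → Space n → Space n → ℝ → ℝ → ℝ}
    {A : Set ℝ} (hT : SmoothDensity T) (hC : IsConserved P A T) {s : ℝ} (hs : s ∈ A)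
    {l : ℝ} (hl : 0 ≤ l) {t₀ t : ℝ} (ht : t₀ - 1 / (1 + l) < t) (x u : Space n)
    {r : ℝ} (hr : 0 < r) :
    T t (x + (t - t₀) • u) u (r / (1 + l * (t - t₀)) ^ n) s / (r / (1 + l * (t - t₀)) ^ n) =
      T t₀ x u r s / r := by
  have hF := isFlowMap_expansion hl t₀ x u (b := max t t₀ + 1)
    (lt_of_le_of_lt (le_max_right _ _) (lt_add_one _))
  have := specific_density_along_flow hT hC (isEulerSolution_expansion P l t₀ x u hr s)
    (fun _ _ _ => hs) hF (t := t) ⟨ht, lt_of_le_of_lt (le_max_left _ _) (lt_add_one _)⟩ (mem_univ x)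
  simpa [expansionVelocity] using this

theorem density_free_motion {P : ℝ → ℝ → ℝ} {T : ℝ → Space n → Space n → ℝ → ℝ → ℝ}
    {A : Set ℝ} (hT : SmoothDensity T) (hC : IsConserved P A T) {s : ℝ} (hs : s ∈ A)
    {t₀ t : ℝ} (ht : t₀ - 1 < t) (x u : Space n) {r : ℝ} (hr : 0 < r) :
    T t (x + (t - t₀) • u) u r s = T t₀ x u r s := by
  have := specific_density_expansion hT hC hs le_rfl (by simpa using ht) x u hr
  simpa [div_left_inj' hr.ne'] using this

/-- A conserved density is proportional to the mass density. -/
theorem density_eq_mul {P : ℝ → ℝ → ℝ} {T : ℝ → Space n → Space n → ℝ → ℝ → ℝ}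
    {A : Set ℝ} (hn : n ≠ 0) (hT : SmoothDensity T) (hC : IsConserved P A T) {s : ℝ} (hs : s ∈ A)
    (t : ℝ) (x u : Space n) {r : ℝ} (hr : 0 < r) : T t x u r s = r * T t x u 1 s := by
  have key : ∀ r₀ r₁ : ℝ, 0 < r₁ → r₁ ≤ r₀ → T t x u r₁ s / r₁ = T t x u r₀ s / r₀ := by
    intro r₀ r₁ h₁ h
    have h₀ := h₁.trans_le h
    -- This rate dilutes `r₀` to `r₁` in unit time.
    obtain ⟨l, hl, hlr⟩ : ∃ l : ℝ, 0 ≤ l ∧ (1 + l) ^ n = r₀ / r₁ := by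
      refine ⟨(r₀ / r₁) ^ ((n : ℝ)⁻¹) - 1, ?_, ?_⟩
      · have := Real.one_le_rpow ((one_le_div h₁).2 h) (z := (n : ℝ)⁻¹) (by positivity)
        linarith
      · rw [add_sub_cancel, Real.rpow_inv_natCast_pow (by positivity) hn]
    have e := specific_density_expansion hT hC hs hl (t₀ := t - 1) (t := t)
      (by have : 0 < 1 / (1 + l) := by positivity
          linarith) (x - u) u h₀
    -- The diluted and the undiluted particle leave `(t - 1, x - u)` in the same state and both
    -- reach `(t, x)` with velocity `u`.
    have e' := density_free_motion hT hC hs (t₀ := t - 1) (t := t) (by linarith) (x - u) u h₀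
    simp only [sub_sub_cancel, one_smul, sub_add_cancel, mul_one, hlr] at e e'
    rw [← e'] at e
    rwa [show r₀ / (r₀ / r₁) = r₁ by field_simp] at e
  have : T t x u r s / r = T t x u 1 s / 1 := by
    rcases le_total r 1 with h | h
    · exact key 1 r hr h
    · exact (key r 1 one_pos h).symm
  field_simp at this
  simpa [mul_comm] using this

end Expansion

/-! ### Rotations in a plane -/

/-- An infinitesimal rotation `J` with `J³ = -J`, that is, one of a single plane at unit speed. -/
structure IsPlaneRotation {n : ℕ} (J : Space n →L[ℝ] Space n) : Prop where
  inner_self : ∀ x, inner ℝ (J x) x = 0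
  cube : ∀ x, J (J (J x)) = -J x

/-- Half the squared distance from the rotation axis. -/
def axialSq {n : ℕ} (J : Space n →L[ℝ] Space n) (x : Space n) : ℝ := inner ℝ (J x) (J x) / 2

/-- The rotation by the angle `θ` generated by `J` (Rodrigues' formula). -/
def rotation {n : ℕ} (J : Space n →L[ℝ] Space n) (θ : ℝ) (x : Space n) : Space n :=
  x + Real.sin θ • J x + (1 - Real.cos θ) • J (J x)

namespace IsPlaneRotation

variable {n : ℕ} {J : Space n →L[ℝ] Space n}

theorem inner_swap (hJ : IsPlaneRotation J) (x y : Space n) :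
    inner ℝ (J x) y = -inner ℝ (J y) x := by
  have h := hJ.inner_self (x + y)
  simp only [map_add, inner_add_left, inner_add_right, hJ.inner_self] at h
  linarith

/-- The gradient `-J (J x)` is the outward radial vector, which is what lets a pressure depending on
`axialSq` balance rotation. -/
theorem hasFDerivAt_axialSq (hJ : IsPlaneRotation J) (x : Space n) :
    HasFDerivAt (axialSq J) (-innerSL ℝ (J (J x))) x := by
  have h := ((J.hasFDerivAt (x := x)).inner ℝ (J.hasFDerivAt (x := x))).mul_const (1 / 2 : ℝ)
  have e : axialSq J = fun y => inner ℝ (J y) (J y) * (1 / 2 : ℝ) := by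
    funext y; simp [axialSq, div_eq_mul_inv]
  rw [e]
  refine h.congr_fderiv ?_
  ext y
  have h1 := hJ.inner_swap (J x) y
  simp [real_inner_comm (J x) (J y), h1]
  ring

theorem contDiff_axialSq (J : Space n →L[ℝ] Space n) : ContDiff ℝ ∞ (axialSq J) :=
  (J.contDiff.inner ℝ J.contDiff).div_const 2

theorem map_rotation (hJ : IsPlaneRotation J) (θ : ℝ) (x : Space n) :
    J (rotation J θ x) = Real.cos θ • J x + Real.sin θ • J (J x) := by
  simp only [rotation, map_add, map_smul, hJ.cube]
  module

theorem hasDerivAt_rotation (hJ : IsPlaneRotation J) (θ : ℝ) (x : Space n) :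
    HasDerivAt (fun θ => rotation J θ x) (J (rotation J θ x)) θ := by
  have h : HasDerivAt (fun θ => rotation J θ x) _ θ :=
    (((Real.hasDerivAt_sin θ).smul_const (J x)).const_add x).add
      (((Real.hasDerivAt_cos θ).const_sub 1).smul_const (J (J x)))
  refine h.congr_deriv ?_
  rw [hJ.map_rotation, neg_neg]

theorem axialSq_rotation (hJ : IsPlaneRotation J) (θ : ℝ) (x : Space n) :
    axialSq J (rotation J θ x) = axialSq J x := by
  have h1 : inner ℝ (J (J x)) (J (J x)) = inner ℝ (J x) (J x) := by
    rw [hJ.inner_swap (J x) (J (J x)), hJ.cube, inner_neg_left, neg_neg]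
  have h2 := hJ.inner_self (J x)
  have h3 : inner ℝ (J x) (J (J x)) = 0 := by rw [real_inner_comm]; exact h2
  simp only [axialSq, hJ.map_rotation, inner_add_left, inner_add_right, real_inner_smul_left,
    real_inner_smul_right, h1, h2, h3]
  linear_combination (inner ℝ (J x) (J x)) / 2 * Real.sin_sq_add_cos_sq θ

end IsPlaneRotation

/-! ### Drifting vortices -/

section Vortex

variable {n : ℕ} {J : Space n →L[ℝ] Space n} {w R Sg : ℝ → ℝ} {Z : Set ℝ}

/-- Velocity of a vortex with angular velocity profile `w`, carried along by a uniform motion. -/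
def vortexVelocity (J : Space n →L[ℝ] Space n) (w : ℝ → ℝ) (t₀ : ℝ) (c v : Space n) (t : ℝ)
    (x : Space n) : Space n :=
  v + w (axialSq J (x - c - (t - t₀) • v)) • J (x - c - (t - t₀) • v)

theorem contDiff_relative (t₀ : ℝ) (c v : Space n) :
    ContDiff ℝ ∞ (fun z : ℝ × Space n => z.2 - c - (z.1 - t₀) • v) := by fun_prop

theorem hasDerivAt_relative {G : Type*} [NormedAddCommGroup G] [NormedSpace ℝ G]
    {ψ : Space n → G} {ψ' : Space n →L[ℝ] G} {t₀ t : ℝ} {c v x : Space n}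
    (h : HasFDerivAt ψ ψ' (x - c - (t - t₀) • v)) :
    HasDerivAt (fun s => ψ (x - c - (s - t₀) • v)) (-ψ' v) t := by
  have h1 : HasDerivAt (fun s => x - c - (s - t₀) • v) (-v) t := by
    simpa using (((hasDerivAt_id t).sub_const t₀).smul_const v).const_sub (x - c)
  simpa [Function.comp_def] using HasFDerivAt.comp_hasDerivAt (f := fun s => x - c - (s - t₀) • v) t h h1

theorem hasFDerivAt_relative {G : Type*} [NormedAddCommGroup G] [NormedSpace ℝ G]
    {ψ : Space n → G} {ψ' : Space n →L[ℝ] G} {c d x : Space n}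
    (h : HasFDerivAt ψ ψ' (x - c - d)) :
    HasFDerivAt (fun y => ψ (y - c - d)) ψ' x := by
  have h1 : HasFDerivAt (fun y => y - c - d) (ContinuousLinearMap.id ℝ (Space n)) x :=
    ((hasFDerivAt_id x).sub_const c).sub_const d
  simpa [Function.comp_def] using HasFDerivAt.comp (f := fun y => y - c - d) x h h1

theorem hasFDerivAt_comp_axialSq (hJ : IsPlaneRotation J) {f : ℝ → ℝ} {f' : ℝ} {y : Space n}
    (h : HasDerivAt f f' (axialSq J y)) :
    HasFDerivAt (fun y => f (axialSq J y)) (f' • (-innerSL ℝ (J (J y)))) y :=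
  h.comp_hasFDerivAt y (hJ.hasFDerivAt_axialSq y)

/-- The centripetal acceleration is `w² J (J y)`, and the hypothesis on `P` is exactly its balance
with the pressure gradient. All profiles are constant on the orbits, and a uniform drift changes
nothing by Galilean invariance. -/
theorem isEulerSolution_vortex {P : ℝ → ℝ → ℝ} (hJ : IsPlaneRotation J) (hZ : IsOpen Z)
    (hw : ContDiffOn ℝ ∞ w Z) (hR : ContDiffOn ℝ ∞ R Z) (hS : ContDiffOn ℝ ∞ Sg Z)
    (hpos : ∀ z ∈ Z, 0 < R z)
    (hp : ∀ z ∈ Z, HasDerivAt (fun z => P (R z) (Sg z)) (R z * w z ^ 2) z)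
    (t₀ : ℝ) (c v : Space n) :
    IsEulerSolution P {z : ℝ × Space n | axialSq J (z.2 - c - (z.1 - t₀) • v) ∈ Z}
      (vortexVelocity J w t₀ c v)
      (fun t x => R (axialSq J (x - c - (t - t₀) • v)))
      (fun t x => Sg (axialSq J (x - c - (t - t₀) • v))) := by
  have hq : ContDiff ℝ ∞ (fun z : ℝ × Space n => axialSq J (z.2 - c - (z.1 - t₀) • v)) :=
    (IsPlaneRotation.contDiff_axialSq J).comp (contDiff_relative t₀ c v)
  have hdiff : ∀ {f : ℝ → ℝ}, ContDiffOn ℝ ∞ f Z → ∀ z ∈ Z, HasDerivAt f (deriv f z) z :=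
    fun hf z hz => ((hf.contDiffAt (hZ.mem_nhds hz)).differentiableAt (by simp)).hasDerivAt
  have hV : ∀ y, axialSq J y ∈ Z → HasFDerivAt (fun y => v + w (axialSq J y) • J y)
      (w (axialSq J y) • J + (deriv w (axialSq J y) • (-innerSL ℝ (J (J y)))).smulRight (J y)) y :=
    fun y hy => ((hasFDerivAt_comp_axialSq hJ (hdiff hw _ hy)).smul J.hasFDerivAt).const_add v
  refine ⟨hZ.preimage hq.continuous, ?_, ?_, ?_, fun t x h => hpos _ h, ?_, ?_, ?_⟩
  · exact contDiffOn_const.add ((hw.comp hq.contDiffOn fun z hz => hz).smul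
      (J.contDiff.comp (contDiff_relative t₀ c v)).contDiffOn)
  · exact hR.comp hq.contDiffOn fun z hz => hz
  · exact hS.comp hq.contDiffOn fun z hz => hz
  · intro t x h
    have h' : axialSq J (x - c - (t - t₀) • v) ∈ Z := h
    have h1 := hasDerivAt_relative (hV _ h')
    have h2 := hasFDerivAt_relative (hV _ h')
    have h3 := hasFDerivAt_relative (hasFDerivAt_comp_axialSq hJ (hp _ h'))
    have hRp := (hpos _ h').ne'
    unfold vortexVelocity gradient
    rw [h1.deriv, h2.fderiv, h3.fderiv]
    set y := x - c - (t - t₀) • v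
    have e : (InnerProductSpace.toDual ℝ (Space n)).symm (-innerSL ℝ (J (J y))) = -J (J y) := by
      rw [map_neg, neg_inj, LinearIsometryEquiv.symm_apply_eq]
      ext; simp
    rw [map_smul, e]
    simp only [add_apply, smul_apply,
      ContinuousLinearMap.smulRight_apply, neg_apply, innerSL_apply_apply,
      map_add, map_smul, hJ.inner_self (J y), smul_smul]
    have e2 : (R (axialSq J y))⁻¹ * (R (axialSq J y) * w (axialSq J y) ^ 2) =
      w (axialSq J y) ^ 2 := by field_simp
    rw [e2]
    simp only [smul_eq_mul]
    module
  · intro t x h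
    have h' : axialSq J (x - c - (t - t₀) • v) ∈ Z := h
    have h2 := hasFDerivAt_relative (hV _ h')
    have hR' := hasFDerivAt_comp_axialSq hJ (hdiff hR _ h')
    rw [(hasDerivAt_relative hR').deriv, divergence_smul (v := vortexVelocity J w t₀ c v t)
      (hasFDerivAt_relative hR').differentiableAt h2.differentiableAt,
      (hasFDerivAt_relative hR').fderiv]
    -- `J` has zero trace, and the gradient of `w` is radial, hence orthogonal to the swirl `J y`.
    have hdiv : divergence (vortexVelocity J w t₀ c v t) x = 0 := by
      unfold vortexVelocity divergence
      rw [h2.fderiv]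
      set y := x - c - (t - t₀) • v
      have e1 : ∀ i, J (EuclideanSpace.single i 1) i = 0 := fun i => by
        have := hJ.inner_self (EuclideanSpace.single i 1)
        simpa [EuclideanSpace.inner_single_right] using this
      have e3 : ∑ i, (J (J y)) i * (J y) i = 0 := by
        have := hJ.inner_self (J y)
        rw [PiLp.inner_apply] at this
        simpa [mul_comm] using this
      simp [e1, EuclideanSpace.inner_single_right, mul_assoc, ← Finset.mul_sum, e3]
    rw [hdiv]
    unfold vortexVelocity
    generalize x - c - (t - t₀) • v = y
    simp [inner_add_right, real_inner_smul_right, hJ.inner_self]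
  · intro t x h
    have h' : axialSq J (x - c - (t - t₀) • v) ∈ Z := h
    have hS' := hasFDerivAt_comp_axialSq hJ (hdiff hS _ h')
    rw [(hasDerivAt_relative hS').deriv, (hasFDerivAt_relative hS').fderiv]
    unfold vortexVelocity
    generalize x - c - (t - t₀) • v = y
    simp [inner_add_right, real_inner_smul_right, hJ.inner_self]

/-- The flow map of a vortex. -/
def vortexFlow (J : Space n →L[ℝ] Space n) (w : ℝ → ℝ) (t₀ : ℝ) (c v : Space n) (t : ℝ)
    (x : Space n) : Space n :=
  rotation J (w (axialSq J (x - c)) * (t - t₀)) (x - c) + c + (t - t₀) • v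

theorem isFlowMap_vortex (hJ : IsPlaneRotation J) (hZ : IsOpen Z)
    (hw : ContDiffOn ℝ ∞ w Z) {a t₀ b : ℝ} (ht₀ : t₀ ∈ Ioo a b) (c v : Space n) :
    IsFlowMap {z : ℝ × Space n | axialSq J (z.2 - c - (z.1 - t₀) • v) ∈ Z}
      (vortexVelocity J w t₀ c v) a t₀ b {x | axialSq J (x - c) ∈ Z}
      (vortexFlow J w t₀ c v) := by
  have hrel : ∀ t x, vortexFlow J w t₀ c v t x - c - (t - t₀) • v =
      rotation J (w (axialSq J (x - c)) * (t - t₀)) (x - c) := fun t x => by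
    simp [vortexFlow, sub_sub]
  have hq : ContDiff ℝ ∞ (fun x : Space n => axialSq J (x - c)) :=
    (IsPlaneRotation.contDiff_axialSq J).comp (by fun_prop)
  refine ⟨ht₀, hZ.preimage hq.continuous, ?_, ?_, ?_, ?_⟩
  · have h1 : ContDiffOn ℝ ∞ (fun z : ℝ × Space n => w (axialSq J (z.2 - c)) * (z.1 - t₀))
        (Ioo a b ×ˢ {x | axialSq J (x - c) ∈ Z}) :=
      (hw.comp (hq.comp contDiff_snd).contDiffOn fun z hz => hz.2).mul (by fun_prop)
    have h2 : ContDiff ℝ ∞ (fun z : ℝ × Space n => z.2 - c) := by fun_prop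
    unfold vortexFlow rotation
    refine ContDiffOn.add (ContDiffOn.add (ContDiffOn.add (ContDiffOn.add h2.contDiffOn ?_) ?_)
      contDiffOn_const) (by fun_prop)
    · exact (Real.contDiff_sin.comp_contDiffOn h1).smul (J.contDiff.comp h2).contDiffOn
    · exact (contDiffOn_const.sub (Real.contDiff_cos.comp_contDiffOn h1)).smul
        (J.contDiff.comp (J.contDiff.comp h2)).contDiffOn
  · intro x _
    simp [vortexFlow, rotation]
  · intro t _ x hx
    simpa only [mem_ofPred_eq, hrel, hJ.axialSq_rotation] using hx
  · intro t _ x _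
    have h1 : HasDerivAt (fun t => w (axialSq J (x - c)) * (t - t₀)) (w (axialSq J (x - c))) t := by
      simpa using ((hasDerivAt_id t).sub_const t₀).const_mul (w (axialSq J (x - c)))
    have h2 := HasDerivAt.scomp (g₁ := fun θ => rotation J θ (x - c)) t
      (hJ.hasDerivAt_rotation _ (x - c)) h1
    have h3 : HasDerivAt (fun t => (t - t₀) • v) v t := by
      simpa using ((hasDerivAt_id t).sub_const t₀).smul_const v
    refine ((h2.add_const c).add h3).congr_deriv ?_
    rw [vortexVelocity, hrel, hJ.axialSq_rotation, add_comm]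

end Vortex

/-! ### Classification of conserved densities -/

section Classification

variable {n : ℕ}

/-- The infinitesimal rotation taking the `i`-th coordinate direction to the `j`-th. -/
def planeRotation (i j : Fin n) : Space n →L[ℝ] Space n :=
  (EuclideanSpace.proj (𝕜 := ℝ) i : Space n →L[ℝ] ℝ).smulRight (EuclideanSpace.single j 1) -
    (EuclideanSpace.proj (𝕜 := ℝ) j : Space n →L[ℝ] ℝ).smulRight (EuclideanSpace.single i 1)

theorem planeRotation_apply (i j : Fin n) (x : Space n) : planeRotation i j x =
    x i • EuclideanSpace.single j (1 : ℝ) - x j • EuclideanSpace.single i (1 : ℝ) := rfl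

theorem planeRotation_single {i j : Fin n} (h : i ≠ j) :
    planeRotation i j (EuclideanSpace.single i 1) = EuclideanSpace.single j 1 := by
  simp [planeRotation_apply, h.symm]

theorem planeRotation_single' {i j : Fin n} (h : i ≠ j) :
    planeRotation i j (EuclideanSpace.single j 1) = -EuclideanSpace.single i 1 := by
  simp [planeRotation_apply, h]

theorem isPlaneRotation_planeRotation {i j : Fin n} (h : i ≠ j) :
    IsPlaneRotation (planeRotation i j) where
  inner_self x := by
    simp [planeRotation_apply, inner_sub_left, real_inner_smul_left, EuclideanSpace.inner_single_left]
    ring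
  cube x := by
    rw [planeRotation_apply i j x]
    simp only [map_sub, map_smul, map_neg, planeRotation_single h, planeRotation_single' h]
    module

variable {P : ℝ → ℝ → ℝ} {T : ℝ → Space n → Space n → ℝ → ℝ → ℝ} {A : Set ℝ}

/-- Density is constant on each orbit, so the factor `1/ρ` cancels and `T` itself is preserved. -/
theorem specific_density_vortex (hT : SmoothDensity T) (hC : IsConserved P A T)
    {J : Space n →L[ℝ] Space n} (hJ : IsPlaneRotation J) {w R Sg : ℝ → ℝ} {Z : Set ℝ}
    (hZ : IsOpen Z)
    (hw : ContDiffOn ℝ ∞ w Z) (hR : ContDiffOn ℝ ∞ R Z) (hS : ContDiffOn ℝ ∞ Sg Z)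
    (hpos : ∀ z ∈ Z, 0 < R z) (hA : ∀ z ∈ Z, Sg z ∈ A)
    (hp : ∀ z ∈ Z, HasDerivAt (fun z => P (R z) (Sg z)) (R z * w z ^ 2) z)
    (t₀ t : ℝ) (c v : Space n) {x : Space n} (hx : axialSq J (x - c) ∈ Z) :
    T t (vortexFlow J w t₀ c v t x) (vortexVelocity J w t₀ c v t (vortexFlow J w t₀ c v t x))
      (R (axialSq J (x - c))) (Sg (axialSq J (x - c))) =
    T t₀ x (vortexVelocity J w t₀ c v t₀ x) (R (axialSq J (x - c))) (Sg (axialSq J (x - c))) := by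
  have hrel : vortexFlow J w t₀ c v t x - c - (t - t₀) • v =
      rotation J (w (axialSq J (x - c)) * (t - t₀)) (x - c) := by
    simp [vortexFlow, sub_sub]
  have hF := isFlowMap_vortex hJ hZ hw (a := min t t₀ - 1) (b := max t t₀ + 1) (t₀ := t₀)
    ⟨by linarith [min_le_right t t₀], by linarith [le_max_right t t₀]⟩ c v
  have := specific_density_along_flow hT hC (isEulerSolution_vortex hJ hZ hw hR hS hpos hp t₀ c v)
    (fun t x h => hA _ h) hF (t := t)
    ⟨by linarith [min_le_left t t₀], by linarith [le_max_left t t₀]⟩ hx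
  simp only [hrel, hJ.axialSq_rotation, sub_self, zero_smul, sub_zero] at this
  exact (div_left_inj' (hpos _ hx).ne').1 this

/-- At a state where the pressure varies, a conserved density does not depend on the velocity. -/
theorem fderiv_velocity_eq_zero (hT : SmoothDensity T) (hC : IsConserved P A T)
    (hP : SmoothState P) {i j : Fin n} (hij : i ≠ j) {r s σ τ : ℝ} (hr : 0 < r)
    (hA : ∀ z, s + τ * z ∈ A)
    (hd : 0 < deriv (fun z => P (r + σ * z) (s + τ * z)) 0)
    (t₀ : ℝ) (x₀ u₀ : Space n) :
    DifferentiableAt ℝ (fun u => T t₀ x₀ u r s) u₀ ∧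
      fderiv ℝ (fun u => T t₀ x₀ u r s) u₀ (EuclideanSpace.single i 1) = 0 := by
  set J := planeRotation i j
  have hJ : IsPlaneRotation J := isPlaneRotation_planeRotation hij
  set e : Space n := EuclideanSpace.single i 1
  have hJJ : J (J e) = -e := by
    simp only [J, e, planeRotation_single hij, planeRotation_single' hij]
  have hq : axialSq J e = 1 / 2 := by
    simp [axialSq, J, e, planeRotation_single hij]
  -- The profiles are centred at `1 / 2`, the value of `axialSq` at `e`, so that the particle at
  -- offset `e` from the centre has state `(r, s)`.
  let R : ℝ → ℝ := fun z => r + σ * (z - 1 / 2)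
  let Sg : ℝ → ℝ := fun z => s + τ * (z - 1 / 2)
  let p : ℝ → ℝ := fun z => P (R z) (Sg z)
  have hRs : ContDiff ℝ ∞ R := by fun_prop
  have hSs : ContDiff ℝ ∞ Sg := by fun_prop
  have hU : IsOpen {z | 0 < R z} := isOpen_lt continuous_const hRs.continuous
  have hps : ContDiffOn ℝ ∞ p {z | 0 < R z} :=
    ContDiffOn.comp (g := fun z : ℝ × ℝ => P z.1 z.2) hP (hRs.prodMk hSs).contDiffOn
      fun z hz => hz
  have hps' : ContDiffOn ℝ ∞ (deriv p) {z | 0 < R z} := hps.deriv_of_isOpen hU (by simp)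
  let Z : Set ℝ := {z | 0 < R z} ∩ deriv p ⁻¹' Ioi 0
  have hZ : IsOpen Z := hps'.continuousOn.isOpen_inter_preimage hU isOpen_Ioi
  -- The force balance `R w² = p'` solved for `w`; hence the restriction to increasing pressure.
  let w : ℝ → ℝ := fun z => Real.sqrt (deriv p z / R z)
  have hw : ContDiffOn ℝ ∞ w Z :=
    ((hps'.mono inter_subset_left).div hRs.contDiffOn fun z hz => (ne_of_gt hz.1)).sqrt
      fun z hz => (div_pos hz.2 hz.1).ne'
  have hp : ∀ z ∈ Z, HasDerivAt (fun z => P (R z) (Sg z)) (R z * w z ^ 2) z := by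
    intro z hz
    have h1 : R z ≠ 0 := ne_of_gt hz.1
    have h2 : R z * w z ^ 2 = deriv p z := by
      simp only [w]
      rw [Real.sq_sqrt (div_pos hz.2 hz.1).le]
      field_simp
    rw [h2]
    exact ((hps.contDiffAt (hU.mem_nhds hz.1)).differentiableAt (by simp)).hasDerivAt
  have hhalf : (1 / 2 : ℝ) ∈ Z := by
    refine ⟨by simpa [R] using hr, ?_⟩
    have h1 : p = fun z => (fun z => P (r + σ * z) (s + τ * z)) (z - 1 / 2) := rfl
    rw [mem_preimage, h1, deriv_comp_sub_const (f := fun z => P (r + σ * z) (s + τ * z)), sub_self]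
    exact hd
  have hw0 : 0 < w (1 / 2) := Real.sqrt_pos.2 (div_pos hhalf.2 hhalf.1)
  set α := w (1 / 2)
  -- Centre and drift are chosen so that the particle at `x₀` has velocity exactly `u₀` at time
  -- `t₀`.
  set c := x₀ - e
  set v := u₀ - α • J e
  have hxc : x₀ - c = e := by simp [c]
  have hRr : R (1 / 2) = r := by simp [R]
  have hSr : Sg (1 / 2) = s := by simp [Sg]
  have hs : s ∈ A := by simpa using hA 0
  have hinv : ∀ t, T t (vortexFlow J w t₀ c v t x₀)
      (v + α • J (rotation J (α * (t - t₀)) e)) r s = T t₀ x₀ u₀ r s := by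
    intro t
    have hrel : vortexFlow J w t₀ c v t x₀ - c - (t - t₀) • v = rotation J (α * (t - t₀)) e := by
      simp [vortexFlow, sub_sub, hxc, hq, α]
    have := specific_density_vortex hT hC hJ hZ hw hRs.contDiffOn hSs.contDiffOn
      (fun z hz => hz.1) (fun z _ => hA _) hp t₀ t c v (x := x₀) (by rw [hxc, hq]; exact hhalf)
    simp only [vortexVelocity, hrel, hJ.axialSq_rotation, sub_self, zero_smul, sub_zero, hxc, hq,
      hRr, hSr] at this
    simpa [v, α] using this
  have hopen : IsOpen {z : ℝ × Space n × Space n × ℝ × ℝ | 0 < z.2.2.2.1} :=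
    isOpen_lt (by fun_prop) (by fun_prop)
  obtain ⟨D, hD⟩ : ∃ D, HasFDerivAt (fun z : ℝ × Space n × Space n × ℝ × ℝ =>
      T z.1 z.2.1 z.2.2.1 z.2.2.2.1 z.2.2.2.2) D (t₀, x₀, u₀, r, s) :=
    (ContDiffOn.contDiffAt hT (hopen.mem_nhds hr)).differentiableAt (by simp)
  have hu : HasFDerivAt (fun u => T t₀ x₀ u r s)
      (D ∘L ContinuousLinearMap.inr ℝ ℝ _ ∘L ContinuousLinearMap.inr ℝ (Space n) _ ∘L
        ContinuousLinearMap.inl ℝ (Space n) (ℝ × ℝ)) u₀ := by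
    refine HasFDerivAt.comp (f := fun u : Space n => (t₀, x₀, u, r, s)) u₀ hD ?_
    exact (hasFDerivAt_prodMk_right t₀ (x₀, u₀, r, s)).comp u₀
      ((hasFDerivAt_prodMk_right x₀ (u₀, r, s)).comp u₀ (hasFDerivAt_prodMk_left u₀ (r, s)))
  refine ⟨hu.differentiableAt, ?_⟩
  rw [hu.fderiv]
  have hlin : HasDerivAt (fun t => x₀ + (t - t₀) • u₀) u₀ t₀ := by
    simpa using (((hasDerivAt_id t₀).sub_const t₀).smul_const u₀).const_add x₀
  -- Derivative of `T` along free motion; the vortex particle gives the same with its acceleration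
  -- added.
  have h1 : D (1, u₀, 0, 0, 0) = 0 := by
    have hc : HasDerivAt (fun t => T t (x₀ + (t - t₀) • u₀) u₀ r s) (D (1, u₀, 0, 0, 0)) t₀ := by
      refine HasFDerivAt.comp_hasDerivAt (f := fun t => (t, x₀ + (t - t₀) • u₀, u₀, r, s)) t₀
        (by simpa using hD) ?_
      exact (hasDerivAt_id t₀).prodMk (hlin.prodMk (hasDerivAt_const t₀ (u₀, r, s)))
    refine hc.unique ((hasDerivAt_const t₀ (T t₀ x₀ u₀ r s)).congr_of_eventuallyEq ?_)
    filter_upwards [Ioi_mem_nhds (sub_one_lt t₀)] with t ht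
    exact density_free_motion hT hC hs ht x₀ u₀ hr
  have h2 : D (1, u₀, α • J (α • J e), 0, 0) = 0 := by
    have hrot0 : rotation J (α * (t₀ - t₀)) e = e := by simp [rotation]
    have hang : HasDerivAt (fun t => α * (t - t₀)) α t₀ := by
      simpa using ((hasDerivAt_id t₀).sub_const t₀).const_mul α
    have hrot : HasDerivAt (fun t => rotation J (α * (t - t₀)) e) (α • J e) t₀ := by
      have := HasDerivAt.scomp (g₁ := fun θ => rotation J θ e) t₀ (hJ.hasDerivAt_rotation _ e) hang
      rwa [hrot0] at this
    have hvel : HasDerivAt (fun t => v + α • J (rotation J (α * (t - t₀)) e))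
        (α • J (α • J e)) t₀ :=
      ((J.hasFDerivAt.comp_hasDerivAt t₀ hrot).const_smul α).const_add v
    have hpos : HasDerivAt (fun t => vortexFlow J w t₀ c v t x₀) u₀ t₀ := by
      have hF := isFlowMap_vortex hJ hZ hw (a := t₀ - 1) (b := t₀ + 1) (t₀ := t₀)
        ⟨by linarith, by linarith⟩ c v
      have hx : x₀ ∈ {x | axialSq J (x - c) ∈ Z} := by
        rw [mem_ofPred_eq, hxc, hq]; exact hhalf
      have := hF.velocity t₀ hF.time_mem x₀ hx
      rw [hF.initial x₀ hx] at this
      refine this.congr_deriv ?_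
      simp only [vortexVelocity, sub_self, zero_smul, sub_zero, hxc, hq]
      simp [v, α]
    have h0 : (t₀, vortexFlow J w t₀ c v t₀ x₀, v + α • J (rotation J (α * (t₀ - t₀)) e), r, s) =
        (t₀, x₀, u₀, r, s) := by
      rw [hrot0]
      simp [vortexFlow, rotation, v]
    have hc : HasDerivAt (fun t => T t (vortexFlow J w t₀ c v t x₀)
        (v + α • J (rotation J (α * (t - t₀)) e)) r s) (D (1, u₀, α • J (α • J e), 0, 0)) t₀ := by
      refine HasFDerivAt.comp_hasDerivAt (f := fun t => (t, vortexFlow J w t₀ c v t x₀,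
        v + α • J (rotation J (α * (t - t₀)) e), r, s)) t₀ (by rw [h0]; exact hD) ?_
      exact (hasDerivAt_id t₀).prodMk (hpos.prodMk (hvel.prodMk (hasDerivAt_const t₀ (r, s))))
    refine hc.unique ((hasDerivAt_const t₀ (T t₀ x₀ u₀ r s)).congr_of_eventuallyEq ?_)
    exact Filter.Eventually.of_forall hinv
  have h3 : D (0, 0, α • J (α • J e), 0, 0) = 0 := by
    have : ((0 : ℝ), (0 : Space n), α • J (α • J e), (0 : ℝ), (0 : ℝ)) =
        (1, u₀, α • J (α • J e), 0, 0) - (1, u₀, 0, 0, 0) := by simp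
    rw [this, map_sub, h1, h2, sub_zero]
  have h4 : ((0 : ℝ), (0 : Space n), α • J (α • J e), (0 : ℝ), (0 : ℝ)) =
      (-(α * α)) • ((0 : ℝ), (0 : Space n), e, (0 : ℝ), (0 : ℝ)) := by
    simp [map_smul, hJJ, smul_smul]
  rw [h4, map_smul, smul_eq_zero] at h3
  exact h3.resolve_left (by simpa using hw0.ne')

/-- One state where the pressure varies is enough for the whole entropy level, since proportionality
to `ρ` carries velocity independence from density `r` to all others. -/
theorem density_eq_of_state (hn : 1 < n) (hT : SmoothDensity T) (hC : IsConserved P A T)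
    (hP : SmoothState P) {r s σ τ : ℝ} (hr : 0 < r) (hA : ∀ z, s + τ * z ∈ A)
    (hd : 0 < deriv (fun z => P (r + σ * z) (s + τ * z)) 0)
    (t : ℝ) (x u : Space n) {ρ : ℝ} (hρ : 0 < ρ) :
    T t x u ρ s = ρ * T 0 0 0 1 s := by
  have hs : s ∈ A := by simpa using hA 0
  have hn0 : n ≠ 0 := by omega
  have : Nontrivial (Fin n) := Fin.nontrivial_iff_two_le.2 hn
  have hvel : ∀ t x u, T t x u 1 s = T t x 0 1 s := by
    intro t x u
    have hz : ∀ u₀, DifferentiableAt ℝ (fun u => T t x u r s) u₀ ∧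
        fderiv ℝ (fun u => T t x u r s) u₀ = 0 := by
      intro u₀
      have h := fun i : Fin n =>
        let ⟨j, hj⟩ := exists_ne i
        fderiv_velocity_eq_zero hT hC hP hj.symm hr hA hd t x u₀
      refine ⟨(h ⟨0, by omega⟩).1, ?_⟩
      apply ContinuousLinearMap.coe_injective
      refine (EuclideanSpace.basisFun (Fin n) ℝ).toBasis.ext fun i => ?_
      simpa using (h i).2
    have h := is_const_of_fderiv_eq_zero (𝕜 := ℝ) (fun u₀ => (hz u₀).1) (fun u₀ => (hz u₀).2) u 0
    simp only [density_eq_mul hn0 hT hC hs t x _ hr] at h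
    exact mul_left_cancel₀ hr.ne' h
  -- Velocity being irrelevant, a free particle may be given the speed that takes it from `x` to
  -- `x'`.
  have hmove : ∀ t t' x x', t < t' → T t x 0 1 s = T t' x' 0 1 s := by
    intro t t' x x' h
    have h' : t' - t ≠ 0 := by linarith
    have := density_free_motion hT hC hs (t₀ := t) (t := t') (by linarith) x
      ((t' - t)⁻¹ • (x' - x)) one_pos
    rw [smul_inv_smul₀ h', add_sub_cancel, hvel t', hvel t] at this
    exact this.symm
  -- Both events are joined to a common event later than `t` and `0`.
  rw [density_eq_mul hn0 hT hC hs t x u hρ, hvel,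
    hmove t (max t 0 + 1) x 0 (by linarith [le_max_left t 0]),
    hmove 0 (max t 0 + 1) 0 0 (by linarith [le_max_right t 0])]

/-- Moving along the derivative itself makes the rate a square. The entropy stays fixed, so this
also serves isentropic flow. -/
theorem exists_direction_of_density {s₀ r : ℝ}
    (h : deriv (fun r' => P r' s₀) r ≠ 0) :
    ∃ σ, 0 < deriv (fun z => P (r + σ * z) (s₀ + 0 * z)) 0 := by
  refine ⟨deriv (fun r' => P r' s₀) r, ?_⟩
  set d := deriv (fun r' => P r' s₀) r
  have h1 : HasDerivAt (fun r' => P r' s₀) d r := (differentiableAt_of_deriv_ne_zero h).hasDerivAt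
  have h2 : HasDerivAt (fun z => r + d * z) d 0 := by
    simpa using ((hasDerivAt_id (0 : ℝ)).const_mul d).const_add r
  have h3 : HasDerivAt (fun z => P (r + d * z) s₀) (d * d) 0 :=
    HasDerivAt.comp (h₂ := fun r' => P r' s₀) 0 (by simpa using h1) h2
  simpa [h3.deriv] using mul_self_pos.2 h

theorem exists_direction_of_entropy {s r : ℝ} (h : deriv (fun s' => P r s') s ≠ 0) :
    ∃ τ, 0 < deriv (fun z => P (r + 0 * z) (s + τ * z)) 0 := by
  refine ⟨deriv (fun s' => P r s') s, ?_⟩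
  set d := deriv (fun s' => P r s') s
  have h1 : HasDerivAt (fun s' => P r s') d s := (differentiableAt_of_deriv_ne_zero h).hasDerivAt
  have h2 : HasDerivAt (fun z => s + d * z) d 0 := by
    simpa using ((hasDerivAt_id (0 : ℝ)).const_mul d).const_add s
  have h3 : HasDerivAt (fun z => P r (s + d * z)) (d * d) 0 :=
    HasDerivAt.comp (h₂ := fun s' => P r s') 0 (by simpa using h1) h2
  simpa [h3.deriv] using mul_self_pos.2 h

theorem contDiff_entropy_dependence (hT : SmoothDensity T) (t : ℝ) (x u : Space n) {ρ : ℝ}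
    (hρ : 0 < ρ) : ContDiff ℝ ∞ (fun s => T t x u ρ s) :=
  ContDiffOn.comp_contDiff (g := fun z : ℝ × Space n × Space n × ℝ × ℝ =>
    T z.1 z.2.1 z.2.2.1 z.2.2.2.1 z.2.2.2.2) (f := fun s => (t, x, u, ρ, s)) hT
    (by fun_prop) (fun _ => hρ)

end Classification

end CompressibleFluid
end

/-! ### The main theorem -/

theorem proposition1 (n : ℕ) (hn : 1 < n) (P : ℝ → ℝ → ℝ)
    (hP : CompressibleFluid.SmoothState P) :
    -- mass and generalized entropy are constants of motion for every equation of state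
    (CompressibleFluid.IsConstantOfMotion (n := n) P (fun _ _ _ ρ _ => ρ) ∧
      ∀ f : ℝ → ℝ, ContDiff ℝ ∞ f → f ≠ 0 →
        CompressibleFluid.IsConstantOfMotion (n := n) P (fun _ _ _ ρ S => ρ * f S)) ∧
    -- there are no others
    (CompressibleFluid.NondegenerateState P →
      ∀ T : ℝ → CompressibleFluid.Space n → CompressibleFluid.Space n → ℝ → ℝ → ℝ,
        CompressibleFluid.SmoothDensity T → CompressibleFluid.IsConserved P univ T →
        ∃ f : ℝ → ℝ, ContDiff ℝ ∞ f ∧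
          ∀ t x u ρ S, 0 < ρ → T t x u ρ S = ρ * f S) ∧
    -- in flows of constant entropy, with a nonconstant barotropic pressure, only mass remains
    (∀ s₀ : ℝ, (∃ r : ℝ, 0 < r ∧ deriv (fun r' => P r' s₀) r ≠ 0) →
      ∀ T : ℝ → CompressibleFluid.Space n → CompressibleFluid.Space n → ℝ → ℝ → ℝ,
        CompressibleFluid.SmoothDensity T → CompressibleFluid.IsConserved P {s₀} T →
        ∃ c : ℝ, ∀ t x u ρ, 0 < ρ → T t x u ρ s₀ = c * ρ) := by
  refine ⟨⟨⟨?_, ?_⟩, fun f hf hf0 => ⟨?_, ?_⟩⟩, fun hN T hT hC => ?_, fun s₀ ⟨r, hr, hd⟩ T hT hC => ?_⟩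
  · simpa using CompressibleFluid.isConserved_density_mul (n := n) (P := P)
      (f := fun _ => 1) continuous_const univ
  · simpa using CompressibleFluid.not_isTrivialDensity (n := n) (f := fun _ => 1) one_ne_zero
  · exact CompressibleFluid.isConserved_density_mul hf.continuous univ
  · exact CompressibleFluid.not_isTrivialDensity hf0
  · refine ⟨fun s => T 0 0 0 1 s,
      CompressibleFluid.contDiff_entropy_dependence hT 0 0 0 one_pos, fun t x u ρ s hρ => ?_⟩
    -- Both sides are continuous in the entropy, so agreement on the dense set of nondegenerate
    -- entropies suffices.
    refine congrFun (Continuous.ext_on hN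
      (CompressibleFluid.contDiff_entropy_dependence hT t x u hρ).continuous
      (continuous_const.mul
        (CompressibleFluid.contDiff_entropy_dependence hT 0 0 0 one_pos).continuous)
      fun s' hs' => ?_) s
    obtain ⟨r, hr, h | h⟩ := hs'
    · obtain ⟨σ, hσ⟩ := CompressibleFluid.exists_direction_of_density h
      exact CompressibleFluid.density_eq_of_state hn hT hC hP hr (fun _ => mem_univ _) hσ t x u hρ
    · obtain ⟨τ, hτ⟩ := CompressibleFluid.exists_direction_of_entropy h
      exact CompressibleFluid.density_eq_of_state hn hT hC hP hr (fun _ => mem_univ _) hτ t x u hρ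
  · obtain ⟨σ, hσ⟩ := CompressibleFluid.exists_direction_of_density hd
    refine ⟨T 0 0 0 1 s₀, fun t x u ρ hρ => ?_⟩
    rw [CompressibleFluid.density_eq_of_state hn hT hC hP hr (fun _ => by simp) hσ t x u hρ,
      mul_comm]
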